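/- Let $X$ be a finite set with at least two elements and let $X^*$ be the set of finite words over $X$, regarded as a rooted tree with an edge from $w$ to $wx$ for all $w \in X^*$, $x \in X$. For $g \in \operatorname{Aut}(X^*)$ and $w \in X^*$, the section $g_w \in \operatorname{Aut}(X^*)$ is given by $g(wu) = g(w)\,g_w(u)$ for all $u \in X^*$, and the portrait of $g$ is the labelling $X^* \to \operatorname{Sym}(X)$ whose label at $w$ is the permutation that $g_w$ induces on $X$. The portrait map is a bijection from $\operatorname{Aut}(X^*)$ onto $\operatorname{Sym}(X)^{X^*}$; give $\operatorname{Aut}(X^*)$ the topology that corresponds to the prodiscrete topology on $\operatorname{Sym}(X)^{X^*}$. A subgroup $H \le \operatorname{Aut}(X^*)$ is self-similar if $h_w \in H$ for all $h \in H$, $w \in X^*$; it is self-replicating if it is self-similar and for all $g \in H$, $u \in X^*$ there is $h \in H$ with $h(u) = u$ and $h_u = g$; it is level-transitive if it acts transitively on $X^n$ for every $n \ge 0$. Let $G \le \operatorname{Aut}(X^*)$ be a self-similar, level-transitive subgroup such that $G$, or its normalizer in $\operatorname{Aut}(X^*)$, contains a self-replicating, level-transitive subgroup. If $G$ satisfies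 an algebraic law (some nontrivial element of a free group is mapped to $1$ by every homomorphism of the free group to $G$), or if $G$ has a nontrivial center, then the set of portraits of the elements of the topological closure $\overline{G}$ is not Rabin-recognizable, and it is not definable in $SkS$ with $k = |X|$. Here a Rabin automaton consists of a finite set $S$ of states, a set $\mathcal{T} \subseteq S \times \operatorname{Sym}(X) \times S^X$ of transitions, a nonempty set $\mathcal{I} \subseteq S$ of initial states, and a collection $\mathcal{F}$ of subsets of $S$. It accepts a labelling $f$ if there is a map $r : X^* \to S$ with $r(\epsilon) \in \mathcal{I}$ and $(r(w), f(w), (r(wx))_{x \in X}) \in \mathcal{T}$ for all $w \in X^*$, such that for every ray (infinite directed path from the root) the set of states that $r$ takes infinitely often along the ray belongs to $\mathcal{F}$. A set of labellings is Rabin-recognizable if it is the set of labellings accepted by some Rabin automaton. It is definable in $SkS$ if it is the set of labellings that satisfy some sentence of monadic second-order logic over the tree $X^*$, with the successor functions $w \mapsto wx$ ($x \in X$) and a unary predicate for each label. -/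

import Mathlib

/-! ### The tree `X*` and its automorphisms -/

/-- The edge relation of the rooted tree `X*` (the right Cayley graph of the free monoid on `X`):
there is an edge from `v` to `vx` for every word `v` and letter `x`. Words are lists. -/
def TreeEdge (X : Type*) (u v : List X) : Prop := ∃ x : X, v = u ++ [x]

/-- `Aut(X*)`: automorphisms of the directed graph `X*`. The product is composition,
`(g * h) w = g (h w)`. -/
abbrev TreeAut (X : Type*) := TreeEdge X ≃r TreeEdge X

namespace TreeAut

variable {X : Type*}

theorem map_nil (g : TreeAut X) : g [] = [] := by
  rcases List.eq_nil_or_concat (g []) with h | ⟨u, x, h⟩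
  · exact h
  · exfalso
    have h1 : TreeEdge X (g (g.symm u)) (g []) := ⟨x, by simpa using h⟩
    obtain ⟨y, hy⟩ := g.map_rel_iff.1 h1
    simp at hy

theorem exists_append (g : TreeAut X) (w u : List X) :
    ∃ v, g (w ++ u) = g w ++ v ∧ v.length = u.length := by
  induction u using List.reverseRecOn with
  | nil => exact ⟨[], by simp, rfl⟩
  | append_singleton u x ih =>
    obtain ⟨v, hv, hl⟩ := ih
    obtain ⟨y, hy⟩ := (g.map_rel_iff (a := w ++ u) (b := w ++ (u ++ [x]))).2 ⟨x, by simp⟩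
    exact ⟨v ++ [y], by rw [hy, hv]; simp, by simp [hl]⟩

theorem length_map (g : TreeAut X) (w : List X) : (g w).length = w.length := by
  obtain ⟨v, hv, hl⟩ := g.exists_append [] w
  rw [map_nil, List.nil_append, List.nil_append] at hv
  rw [hv, hl]

theorem append_drop (g : TreeAut X) (w u : List X) :
    g (w ++ u) = g w ++ (g (w ++ u)).drop w.length := by
  obtain ⟨v, hv, -⟩ := g.exists_append w u
  rw [hv, ← g.length_map w, List.drop_left]

theorem symm_append_drop (g : TreeAut X) (w u : List X) :
    g.symm (g w ++ u) = w ++ (g.symm (g w ++ u)).drop w.length := by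
  have h := append_drop g.symm (g w) u
  rwa [length_map, RelIso.symm_apply_apply] at h

/-- The section `g_w` of `g` at the word `w`: the automorphism with
`g (w u) = g (w) g_w (u)` for all words `u`. -/
def sectionAt (g : TreeAut X) (w : List X) : TreeAut X where
  toFun u := (g (w ++ u)).drop w.length
  invFun u := (g.symm (g w ++ u)).drop w.length
  left_inv u := by
    change (g.symm (g w ++ (g (w ++ u)).drop w.length)).drop w.length = u
    rw [← append_drop, RelIso.symm_apply_apply, List.drop_left]
  right_inv u := by
    change (g (w ++ (g.symm (g w ++ u)).drop w.length)).drop w.length = u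
    rw [← symm_append_drop, RelIso.apply_symm_apply, ← length_map g w, List.drop_left]
  map_rel_iff' := by
    intro u v
    have h1 : TreeEdge X (w ++ u) (w ++ v) ↔ TreeEdge X u v := by simp [TreeEdge]
    change TreeEdge X ((g (w ++ u)).drop w.length) ((g (w ++ v)).drop w.length) ↔ TreeEdge X u v
    have h2 : TreeEdge X (g (w ++ u)) (g (w ++ v)) ↔ TreeEdge X (w ++ u) (w ++ v) := g.map_rel_iff
    rw [← h1, ← h2, append_drop g w u, append_drop g w v, ← length_map g w, List.drop_left,
      List.drop_left]
    simp [TreeEdge]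

theorem apply_append (g : TreeAut X) (w u : List X) :
    g (w ++ u) = g w ++ g.sectionAt w u :=
  append_drop g w u

theorem exists_letter (g : TreeAut X) (x : X) : ∃ y, g [x] = [y] :=
  List.length_eq_one_iff.1 (by rw [length_map]; rfl)

/-- The permutation of `X` induced by `g` on the first level of the tree. -/
noncomputable def rootPerm (g : TreeAut X) : Equiv.Perm X where
  toFun x := (g.exists_letter x).choose
  invFun x := (exists_letter g.symm x).choose
  left_inv x := by
    have h1 := (g.exists_letter x).choose_spec
    have h2 := (exists_letter g.symm (g.exists_letter x).choose).choose_spec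
    exact (List.singleton_inj.1
      (((g.symm_apply_apply [x]).symm.trans (congrArg g.symm h1)).trans h2)).symm
  right_inv x := by
    have h1 := (exists_letter g.symm x).choose_spec
    have h2 := (g.exists_letter (exists_letter g.symm x).choose).choose_spec
    exact (List.singleton_inj.1
      (((g.apply_symm_apply [x]).symm.trans (congrArg g h1)).trans h2)).symm

theorem apply_singleton (g : TreeAut X) (x : X) : g [x] = [g.rootPerm x] :=
  (g.exists_letter x).choose_spec

/-- The portrait of `g`: the labelling of `X*` by `Sym(X)` whose label at `w` is the permutation
induced on the first level by the section `g_w`. -/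
noncomputable def portrait (g : TreeAut X) : List X → Equiv.Perm X :=
  fun w => (g.sectionAt w).rootPerm

theorem apply_append_singleton (g : TreeAut X) (w : List X) (x : X) :
    g (w ++ [x]) = g w ++ [g.portrait w x] := by
  rw [apply_append, apply_singleton, portrait]

/-- A group of tree automorphisms is self-similar if it contains all sections of its elements. -/
def SelfSimilar (H : Subgroup (TreeAut X)) : Prop :=
  ∀ h ∈ H, ∀ w : List X, h.sectionAt w ∈ H

/-- `H` is self-replicating if it is self-similar and, for every word `u`, the map `h ↦ h_u` from
the stabilizer of `u` in `H` to `H` is surjective. -/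
def SelfReplicating (H : Subgroup (TreeAut X)) : Prop :=
  SelfSimilar H ∧ ∀ u : List X, ∀ g ∈ H, ∃ h ∈ H, h u = u ∧ h.sectionAt u = g

/-- `H` is level-transitive if it is transitive on the words of length `n`, for every `n`. -/
def LevelTransitive (H : Subgroup (TreeAut X)) : Prop :=
  ∀ (n : ℕ) (u v : List X), u.length = n → v.length = n → ∃ h ∈ H, h u = v

end TreeAut

/-- A group satisfies an algebraic law if some nontrivial word of a free group becomes trivial
under all substitutions of elements of the group for its letters. -/
def SatisfiesLaw (G : Type*) [Group G] : Prop :=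
  ∃ w : FreeGroup ℕ, w ≠ 1 ∧ ∀ s : ℕ → G, FreeGroup.lift s w = 1

/-- The prodiscrete topology on the set of configurations `X* → A`. -/
@[reducible]
def prodiscrete (X A : Type*) : TopologicalSpace (List X → A) :=
  @Pi.topologicalSpace (List X) (fun _ => A) (fun _ => ⊥)

/-- The topology of `Aut(X*)`, obtained by identifying automorphisms with their portraits. -/
@[reducible]
noncomputable def treeAutTopology (X : Type*) : TopologicalSpace (TreeAut X) :=
  TopologicalSpace.induced TreeAut.portrait (prodiscrete X (Equiv.Perm X))

/-! ### Rabin automata -/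

/-- An unrestricted Rabin graph with vertex set `S`, tree alphabet `X` and label alphabet `A`. -/
structure RabinGraph (S X A : Type*) where
  /-- The set of transition bundles. -/
  transitions : Set (S × A × (X → S))

namespace RabinGraph

/-- The unrestricted Rabin graph on `X*` associated with a configuration. -/
def ofConfig {X A : Type*} (f : List X → A) : RabinGraph (List X) X A where
  transitions := {t | ∃ w : List X, t = (w, f w, fun x => w ++ [x])}

/-- Homomorphisms of unrestricted Rabin graphs. -/
def IsHom {S S' X A : Type*} (𝒜 : RabinGraph S X A) (ℬ : RabinGraph S' X A) (α : S → S') : Prop :=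
  ∀ (s : S) (a : A) (c : X → S),
    (s, a, c) ∈ 𝒜.transitions → (α s, a, fun x => α (c x)) ∈ ℬ.transitions

end RabinGraph

/-- A Rabin automaton (finiteness of the state set `S` is imposed in `RabinRecognizable`). -/
structure RabinAutomaton (S X A : Type*) extends RabinGraph S X A where
  /-- The set of initial states. -/
  initial : Set S
  initial_nonempty : initial.Nonempty
  /-- The collection of accepting sets of states. -/
  accepting : Set (Set S)

/-- A ray of `X*`: the set of vertices of an infinite directed path that begins at the root. -/
def IsRay {X : Type*} (ρ : Set (List X)) : Prop :=
  ∃ p : ℕ → List X, p 0 = [] ∧ (∀ n, TreeEdge X (p n) (p (n + 1))) ∧ ρ = Set.range p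

namespace RabinAutomaton

variable {S X A : Type*}

/-- Runs of a Rabin automaton on a configuration. -/
def IsRun (𝒜 : RabinAutomaton S X A) (f : List X → A) (r : List X → S) : Prop :=
  (RabinGraph.ofConfig f).IsHom 𝒜.toRabinGraph r ∧ r [] ∈ 𝒜.initial

/-- The set of states that `r` takes infinitely often along `ρ`. -/
def infStates (r : List X → S) (ρ : Set (List X)) : Set S :=
  {s | (r ⁻¹' {s} ∩ ρ).Infinite}

/-- A run is successful if along every ray the set of states taken infinitely often is one of the
accepting sets. -/
def IsSuccessful (𝒜 : RabinAutomaton S X A) (r : List X → S) : Prop :=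
  ∀ ρ : Set (List X), IsRay ρ → ∃ F ∈ 𝒜.accepting, infStates r ρ = F

/-- The set of configurations on which the automaton has a successful run. -/
def language (𝒜 : RabinAutomaton S X A) : Set (List X → A) :=
  {f | ∃ r, 𝒜.IsRun f r ∧ 𝒜.IsSuccessful r}

end RabinAutomaton

/-- A set of configurations is Rabin-recognizable if it is the language of a Rabin automaton with
finitely many states. -/
def RabinRecognizable {X A : Type*} (W : Set (List X → A)) : Prop :=
  ∃ (S : Type) (_ : Finite S) (𝒜 : RabinAutomaton S X A), W = 𝒜.language

/-! ### The monadic second-order theory of `k` successors -/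

/-- Monadic second-order formulas over the tree `X*` with successors `w ↦ wx` for `x : X`, and with
predicates for the labels of a configuration with values in `A`. A formula of type
`SkSFormula X A n m` has `n` free variables for words and `m` free variables for sets of words. -/
inductive SkSFormula (X A : Type*) : ℕ → ℕ → Type _
  | eq {n m : ℕ} (i j : Fin n) : SkSFormula X A n m
  | succ {n m : ℕ} (x : X) (i j : Fin n) : SkSFormula X A n m
  | label {n m : ℕ} (a : A) (i : Fin n) : SkSFormula X A n m
  | mem {n m : ℕ} (i : Fin n) (k : Fin m) : SkSFormula X A n m
  | not {n m : ℕ} (φ : SkSFormula X A n m) : SkSFormula X A n m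
  | and {n m : ℕ} (φ ψ : SkSFormula X A n m) : SkSFormula X A n m
  | exWord {n m : ℕ} (φ : SkSFormula X A (n + 1) m) : SkSFormula X A n m
  | exSet {n m : ℕ} (φ : SkSFormula X A n (m + 1)) : SkSFormula X A n m

/-- Satisfaction of a formula in the tree labelled by `f`, under the assignment `v` of words and
`V` of sets of words to the free variables. -/
def SkSFormula.Sat {X A : Type*} (f : List X → A) : {n m : ℕ} → SkSFormula X A n m →
    (Fin n → List X) → (Fin m → Set (List X)) → Prop
  | _, _, .eq i j, v, _ => v i = v j
  | _, _, .succ x i j, v, _ => v j = v i ++ [x]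
  | _, _, .label a i, v, _ => f (v i) = a
  | _, _, .mem i k, v, V => v i ∈ V k
  | _, _, .not φ, v, V => ¬ φ.Sat f v V
  | _, _, .and φ ψ, v, V => φ.Sat f v V ∧ ψ.Sat f v V
  | _, _, .exWord φ, v, V => ∃ w : List X, φ.Sat f (Fin.cons w v) V
  | _, _, .exSet φ, v, V => ∃ W : Set (List X), φ.Sat f v (Fin.cons W V)

/-- A set of configurations is definable in `SkS` if it is the set of configurations that satisfy
some sentence. -/
def SkSDefinable {X A : Type*} (W : Set (List X → A)) : Prop :=
  ∃ φ : SkSFormula X A 0 0, W = {f | φ.Sat f Fin.elim0 Fin.elim0}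

/-! ### Replacing a subtree -/

/-! Both recognizability and `SkS`-definability force finite type at every vertex. For an automaton,
the type of a labelled subtree is the set of states from which it carries a successful run; for a
formula, types are built by induction, with power sets at the quantifiers
(`SkSFormula.exists_type`).

Suppose the portraits of the closure have finite type at `w`, with `N` types. Level-transitivity
gives `|X|^N > N` elements of `G` that fix `w` and send one word of length `N` below `w` to distinct
words. Two of them have the same type at `w`; grafting the section of one into the other stays in
the closure, and comparing the result with the original gives a nontrivial element supported below
`w` (`hasRigidElements`).

Such elements at every vertex exclude both alternatives. A central element moving `w` cannot commute
with elements approximating one supported below `w`. Conjugating by `G` makes the action on the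
boundary separating, so Abért's theorem rules out laws, whereas a law of `G` passes to `levelClosure
G`. -/

/-- `W` has finite type at `w` if the configurations below `w` fall into finitely many types such
that membership in `W` is preserved when the part below `w` is replaced by one of the same type. -/
def FiniteTypeAt {X A : Type*} (W : Set (List X → A)) (w : List X) : Prop :=
  ∃ (T : Type) (_ : Finite T) (τ : (List X → A) → T), ∀ f f' : List X → A,
    (∀ u, ¬ w <+: u → f u = f' u) →
    τ (fun u => f (w ++ u)) = τ (fun u => f' (w ++ u)) → f ∈ W → f' ∈ W

/-! ### Definable sets -/

namespace SkSFormula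

variable {X A : Type*}

/-- Two labelled trees with assignments agree outside the subtree at `w`; the parts inside are
recorded in `g, c, C` and `g', c', C'`. -/
structure AgreeOff (w : List X) {n m : ℕ} (f f' g g' : List X → A) (v v' : Fin n → List X)
    (c c' : Fin n → Option (List X)) (V V' C C' : Fin m → Set (List X)) : Prop where
  config_off : ∀ u, ¬ w <+: u → f u = f' u
  config_left : ∀ u, f (w ++ u) = g u
  config_right : ∀ u, f' (w ++ u) = g' u
  word : ∀ i, (¬ w <+: v i ∧ v i = v' i ∧ c i = none ∧ c' i = none) ∨
    ∃ a a', v i = w ++ a ∧ v' i = w ++ a' ∧ c i = some a ∧ c' i = some a'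
  set_off : ∀ k u, ¬ w <+: u → (u ∈ V k ↔ u ∈ V' k)
  set_left : ∀ k u, w ++ u ∈ V k ↔ u ∈ C k
  set_right : ∀ k u, w ++ u ∈ V' k ↔ u ∈ C' k

namespace AgreeOff

variable {w : List X} {n m : ℕ} {f f' g g' : List X → A} {v v' : Fin n → List X}
  {c c' : Fin n → Option (List X)} {V V' C C' : Fin m → Set (List X)}

theorem symm (h : AgreeOff w f f' g g' v v' c c' V V' C C') :
    AgreeOff w f' f g' g v' v c' c V' V C' C where
  config_off u hu := (h.config_off u hu).symm
  config_left := h.config_right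
  config_right := h.config_left
  word i := by
    rcases h.word i with ⟨h1, h2, h3, h4⟩ | ⟨a, a', h1, h2, h3, h4⟩
    · exact Or.inl ⟨h2 ▸ h1, h2.symm, h4, h3⟩
    · exact Or.inr ⟨a', a, h2, h1, h4, h3⟩
  set_off k u hu := (h.set_off k u hu).symm
  set_left := h.set_right
  set_right := h.set_left

theorem cons_word_off (h : AgreeOff w f f' g g' v v' c c' V V' C C') {u : List X}
    (hu : ¬ w <+: u) :
    AgreeOff w f f' g g' (Fin.cons u v : Fin (n + 1) → List X) (Fin.cons u v')
      (Fin.cons none c) (Fin.cons none c') V V' C C' :=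
  { h with word := Fin.cases (Or.inl ⟨hu, rfl, rfl, rfl⟩) h.word }

theorem cons_word_in (h : AgreeOff w f f' g g' v v' c c' V V' C C') (a a' : List X) :
    AgreeOff w f f' g g' (Fin.cons (w ++ a) v : Fin (n + 1) → List X) (Fin.cons (w ++ a') v')
      (Fin.cons (some a) c) (Fin.cons (some a') c') V V' C C' :=
  { h with word := Fin.cases (Or.inr ⟨a, a', rfl, rfl, rfl, rfl⟩) h.word }

theorem cons_set (h : AgreeOff w f f' g g' v v' c c' V V' C C') {W W' D D' : Set (List X)}
    (h1 : ∀ u, ¬ w <+: u → (u ∈ W ↔ u ∈ W')) (h2 : ∀ u, w ++ u ∈ W ↔ u ∈ D)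
    (h3 : ∀ u, w ++ u ∈ W' ↔ u ∈ D') :
    AgreeOff w f f' g g' v v' c c' (Fin.cons W V : Fin (m + 1) → Set (List X)) (Fin.cons W' V')
      (Fin.cons D C) (Fin.cons D' C') :=
  { h with
    set_off := Fin.cases h1 h.set_off
    set_left := Fin.cases h2 h.set_left
    set_right := Fin.cases h3 h.set_right }

end AgreeOff

/-- The truth of a formula depends on the subtree at `w` only through finitely many types. -/
theorem exists_type (w : List X) {n m : ℕ} (φ : SkSFormula X A n m) :
    ∃ (T : Type) (_ : Finite T)
      (τ : (List X → A) → (Fin n → Option (List X)) → (Fin m → Set (List X)) → T),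
      ∀ f f' g g' v v' c c' V V' C C', AgreeOff w f f' g g' v v' c c' V V' C C' →
        τ g c C = τ g' c' C' → φ.Sat f v V → φ.Sat f' v' V' := by
  induction φ with
  | eq i j =>
    refine ⟨Prop, inferInstance, fun _ c _ => c i = c j, ?_⟩
    intro f f' g g' v v' c c' V V' C C' h ht (hs : v i = v j)
    change v' i = v' j
    rcases h.word i with ⟨h1, h2, h3, h4⟩ | ⟨a, a', h1, h2, h3, h4⟩ <;>
      rcases h.word j with ⟨k1, k2, k3, k4⟩ | ⟨b, b', k1, k2, k3, k4⟩
    · rw [← h2, ← k2, hs]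
    · exact absurd ⟨b, by rw [hs, k1]⟩ h1
    · exact absurd ⟨a, by rw [← hs, h1]⟩ k1
    · rw [h1, k1, List.append_cancel_left_eq] at hs
      have hab : a' = b' := by simpa [h3, k3, h4, k4, hs] using ht
      rw [h2, k2, hab]
  | succ x i j =>
    -- The second component handles the edge entering the subtree: its source lies outside, so its
    -- target is `w` itself, with relative position `[]`.
    refine ⟨Prop × Prop, inferInstance,
      fun _ c _ => (∃ a, c i = some a ∧ c j = some (a ++ [x]), c j = some []), ?_⟩
    intro f f' g g' v v' c c' V V' C C' h ht (hs : v j = v i ++ [x])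
    change v' j = v' i ++ [x]
    obtain ⟨ht1, ht2⟩ := Prod.ext_iff.1 ht
    dsimp only at ht1 ht2
    rcases h.word i with ⟨h1, h2, h3, h4⟩ | ⟨a, a', h1, h2, h3, h4⟩ <;>
      rcases h.word j with ⟨k1, k2, k3, k4⟩ | ⟨b, b', k1, k2, k3, k4⟩
    · rw [← h2, ← k2, hs]
    · have hw : w = v i ++ [x] := by
        have : w <+: v i ++ [x] := ⟨b, by rw [← hs, k1]⟩
        exact (List.prefix_concat_iff.1 this).resolve_right h1
      have hb : b = [] := by
        rw [k1, ← hw] at hs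
        simpa using hs
      rw [k3, hb, k4] at ht2
      have hb' : b' = [] := by simpa using ht2
      rw [k2, hb', ← h2, List.append_nil, hw]
    · exact absurd ⟨a ++ [x], by rw [hs, h1, List.append_assoc]⟩ k1
    · rw [h1, k1, List.append_assoc, List.append_cancel_left_eq] at hs
      have := ht1.mp ⟨a, h3, hs ▸ k3⟩
      obtain ⟨e, he, he'⟩ := this
      rw [h4, Option.some_inj] at he
      rw [k4, Option.some_inj] at he'
      rw [h2, k2, he', he, List.append_assoc]
  | label a i =>
    refine ⟨Prop, inferInstance, fun g c _ => ∃ u, c i = some u ∧ g u = a, ?_⟩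
    intro f f' g g' v v' c c' V V' C C' h ht (hs : f (v i) = a)
    change f' (v' i) = a
    rcases h.word i with ⟨h1, h2, h3, h4⟩ | ⟨b, b', h1, h2, h3, h4⟩
    · rw [← h2, ← h.config_off _ h1, hs]
    · obtain ⟨e, he, he'⟩ := ht.mp ⟨b, h3, by rw [← h.config_left, ← h1, hs]⟩
      rw [h4, Option.some_inj] at he
      rw [h2, h.config_right, he, he']
  | mem i k =>
    refine ⟨Prop, inferInstance, fun _ c C => ∃ u, c i = some u ∧ u ∈ C k, ?_⟩
    intro f f' g g' v v' c c' V V' C C' h ht (hs : v i ∈ V k)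
    change v' i ∈ V' k
    rcases h.word i with ⟨h1, h2, h3, h4⟩ | ⟨b, b', h1, h2, h3, h4⟩
    · rwa [← h2, ← h.set_off _ _ h1]
    · obtain ⟨e, he, he'⟩ := ht.mp ⟨b, h3, by rwa [← h.set_left, ← h1]⟩
      rw [h4, Option.some_inj] at he
      rwa [h2, h.set_right, he]
  | not φ ih =>
    obtain ⟨T, hT, τ, hτ⟩ := ih
    refine ⟨T, hT, τ, ?_⟩
    intro f f' g g' v v' c c' V V' C C' h ht hs hs'
    -- The hypotheses are symmetric in the two trees, so one-way preservation suffices for negation.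
    exact hs (hτ _ _ _ _ _ _ _ _ _ _ _ _ h.symm ht.symm hs')
  | and φ ψ ih₁ ih₂ =>
    obtain ⟨T₁, hT₁, τ₁, hτ₁⟩ := ih₁
    obtain ⟨T₂, hT₂, τ₂, hτ₂⟩ := ih₂
    refine ⟨T₁ × T₂, inferInstance, fun g c C => (τ₁ g c C, τ₂ g c C), ?_⟩
    intro f f' g g' v v' c c' V V' C C' h ht hs
    obtain ⟨ht1, ht2⟩ := Prod.ext_iff.1 ht
    exact ⟨hτ₁ _ _ _ _ _ _ _ _ _ _ _ _ h ht1 hs.1, hτ₂ _ _ _ _ _ _ _ _ _ _ _ _ h ht2 hs.2⟩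
  | exWord φ ih =>
    obtain ⟨T, hT, τ, hτ⟩ := ih
    -- A witness outside the subtree is kept; for one inside, only the set of attainable types
    -- matters.
    refine ⟨T × Set T, inferInstance,
      fun g c C => (τ g (Fin.cons none c) C, Set.range fun a => τ g (Fin.cons (some a) c) C), ?_⟩
    intro f f' g g' v v' c c' V V' C C' h ht ⟨u, hu⟩
    obtain ⟨ht1, ht2⟩ := Prod.ext_iff.1 ht
    by_cases hw : w <+: u
    · obtain ⟨a, rfl⟩ := hw
      obtain ⟨a', ha'⟩ := (Set.ext_iff.1 ht2 _).1 ⟨a, rfl⟩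
      exact ⟨w ++ a', hτ _ _ _ _ _ _ _ _ _ _ _ _ (h.cons_word_in a a') ha'.symm hu⟩
    · exact ⟨u, hτ _ _ _ _ _ _ _ _ _ _ _ _ (h.cons_word_off hw) ht1 hu⟩
  | exSet φ ih =>
    obtain ⟨T, hT, τ, hτ⟩ := ih
    refine ⟨Set T, inferInstance, fun g c C => Set.range fun D => τ g c (Fin.cons D C), ?_⟩
    intro f f' g g' v v' c c' V V' C C' h ht ⟨W, hW⟩
    obtain ⟨D', hD'⟩ := (Set.ext_iff.1 ht _).1 ⟨{u | w ++ u ∈ W}, rfl⟩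
    -- The new witness is `W` outside the subtree and a copy of `D'` inside.
    refine ⟨{u | (¬ w <+: u ∧ u ∈ W) ∨ ∃ a ∈ D', u = w ++ a},
      hτ _ _ _ _ _ _ _ _ _ _ _ _ (h.cons_set (D := {u | w ++ u ∈ W}) (D' := D') ?_ ?_ ?_)
        hD'.symm hW⟩
    · intro u hu
      constructor
      · exact fun h' => Or.inl ⟨hu, h'⟩
      · rintro (h' | ⟨a, -, rfl⟩)
        · exact h'.2
        · exact absurd (List.prefix_append w a) hu
    · exact fun u => Iff.rfl
    · intro u
      simp

end SkSFormula

theorem SkSDefinable.finiteTypeAt {X A : Type*} {W : Set (List X → A)} (hW : SkSDefinable W)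
    (w : List X) : FiniteTypeAt W w := by
  obtain ⟨φ, rfl⟩ := hW
  obtain ⟨T, hT, τ, hτ⟩ := φ.exists_type w
  refine ⟨T, hT, fun g => τ g Fin.elim0 Fin.elim0, fun f f' hf ht hs => ?_⟩
  exact hτ f f' _ _ _ _ _ _ _ _ _ _
    ⟨hf, fun _ => rfl, fun _ => rfl, fun i => i.elim0, fun i => i.elim0, fun i => i.elim0,
      fun i => i.elim0⟩ ht hs

/-! ### Paths in the tree -/

section Path

variable {X : Type*}

theorem length_of_path {p : ℕ → List X} (h : ∀ n, TreeEdge X (p n) (p (n + 1))) (n : ℕ) :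
    (p n).length = (p 0).length + n := by
  induction n with
  | zero => rfl
  | succ n ih =>
    obtain ⟨x, hx⟩ := h n
    rw [hx, List.length_append, ih, List.length_singleton, add_assoc]

theorem prefix_of_path {p : ℕ → List X} (h : ∀ n, TreeEdge X (p n) (p (n + 1))) {m n : ℕ}
    (hmn : m ≤ n) : p m <+: p n := by
  induction n, hmn using Nat.le_induction with
  | base => exact List.prefix_rfl
  | succ n _ ih =>
    obtain ⟨x, hx⟩ := h n
    rw [hx]
    exact ih.trans (List.prefix_append _ _)

theorem injective_of_path {p : ℕ → List X} (h : ∀ n, TreeEdge X (p n) (p (n + 1))) :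
    Function.Injective p := fun m n hmn => by
  have h1 := length_of_path h m
  have h2 := length_of_path h n
  rw [hmn] at h1
  omega

/-- Every path extends backwards to a path from the root. -/
theorem exists_path_from_root (w : List X) {p : ℕ → List X} (h0 : p 0 = w)
    (h : ∀ n, TreeEdge X (p n) (p (n + 1))) :
    ∃ q : ℕ → List X, q 0 = [] ∧ (∀ n, TreeEdge X (q n) (q (n + 1))) ∧
      ∀ n, q (n + w.length) = p n := by
  induction w using List.reverseRecOn generalizing p with
  | nil => exact ⟨p, h0, h, fun _ => rfl⟩
  | append_singleton w x ih =>
    -- Prepending the parent `w` to `p` gives a path to which the induction hypothesis applies.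
    obtain ⟨q, hq0, hq, hqp⟩ := ih (p := fun n => Nat.casesOn n w p) rfl (by
      rintro (_ | n)
      · exact ⟨x, h0⟩
      · exact h n)
    refine ⟨q, hq0, hq, fun n => ?_⟩
    have := hqp (n + 1)
    rw [List.length_append, List.length_singleton, Nat.add_comm w.length, ← Nat.add_assoc]
    exact this

/-- A path from the root that meets the subtree at `w` passes through `w`. -/
theorem path_apply_length {p : ℕ → List X} (h0 : p 0 = [])
    (h : ∀ n, TreeEdge X (p n) (p (n + 1))) {w : List X} {n : ℕ} (hw : w <+: p n) :
    p w.length = w := by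
  have hl : ∀ k, (p k).length = k := fun k => by rw [length_of_path h, h0]; simp
  have hle : w.length ≤ n := by simpa [hl] using hw.length_le
  exact ((List.prefix_of_prefix_length_le hw (prefix_of_path h hle)
    (by rw [hl])).eq_of_length (by rw [hl])).symm

end Path

/-! ### Rabin-recognizable sets -/

namespace RabinAutomaton

variable {S X A : Type*}

/-- Paths are injective, so counting vertices is the same as counting times. -/
theorem infStates_range (r : List X → S) {p : ℕ → List X}
    (h : ∀ n, TreeEdge X (p n) (p (n + 1))) :
    infStates r (Set.range p) = {s | ∃ᶠ n in Filter.atTop, r (p n) = s} := by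
  ext s
  have : r ⁻¹' {s} ∩ Set.range p = p '' {n | r (p n) = s} := by
    ext u
    constructor
    · rintro ⟨hu, n, rfl⟩
      exact ⟨n, hu, rfl⟩
    · rintro ⟨n, hn, rfl⟩
      exact ⟨hn, n, rfl⟩
  rw [infStates, Set.mem_ofPred_eq, this,
    Set.infinite_image_iff (injective_of_path h).injOn, Set.mem_ofPred_eq,
    Nat.frequently_atTop_iff_infinite]

theorem infStates_eq_of_shift {r r' : List X → S} {p q : ℕ → List X}
    (hp : ∀ n, TreeEdge X (p n) (p (n + 1))) (hq : ∀ n, TreeEdge X (q n) (q (n + 1))) (k : ℕ)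
    (h : ∀ n, r (p n) = r' (q (n + k))) :
    infStates r (Set.range p) = infStates r' (Set.range q) := by
  rw [infStates_range r hp, infStates_range r' hq]
  ext s
  simp only [Set.mem_ofPred_eq, h]
  conv_rhs => rw [← Filter.map_add_atTop_eq_nat k, Filter.frequently_map]

theorem IsSuccessful.below {𝒜 : RabinAutomaton S X A} {r : List X → S} (hr : 𝒜.IsSuccessful r)
    (w : List X) : 𝒜.IsSuccessful fun u => r (w ++ u) := by
  rintro _ ⟨p, hp0, hp, rfl⟩
  have hwp : ∀ n, TreeEdge X (w ++ p n) (w ++ p (n + 1)) := fun n => by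
    obtain ⟨x, hx⟩ := hp n
    exact ⟨x, by rw [hx, List.append_assoc]⟩
  obtain ⟨q, hq0, hq, hqp⟩ := exists_path_from_root w (p := fun n => w ++ p n)
    (by simp [hp0]) hwp
  obtain ⟨F, hF, hrF⟩ := hr _ ⟨q, hq0, hq, rfl⟩
  refine ⟨F, hF, ?_⟩
  rw [← hrF]
  exact infStates_eq_of_shift hp hq w.length fun n => by rw [hqp]

open Classical in
/-- Replace the part of `f` below `w` by `g`. -/
noncomputable def graft {B : Type*} (w : List X) (f g : List X → B) : List X → B :=
  fun u => if w <+: u then g (u.drop w.length) else f u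

theorem graft_append {B : Type*} (w : List X) (f g : List X → B) (u : List X) :
    graft w f g (w ++ u) = g u := by
  simp [graft]

theorem graft_of_not_prefix {B : Type*} {w u : List X} (f g : List X → B) (hu : ¬ w <+: u) :
    graft w f g u = f u := by
  simp [graft, hu]

/-- A ray through `w` has a tail governed by `r₁`; any other ray misses the subtree and sees only
`r`. -/
theorem IsSuccessful.graft {𝒜 : RabinAutomaton S X A} {r r₁ : List X → S} {w : List X}
    (hr : 𝒜.IsSuccessful r) (hr₁ : 𝒜.IsSuccessful r₁) : 𝒜.IsSuccessful (graft w r r₁) := by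
  rintro _ ⟨p, hp0, hp, rfl⟩
  by_cases hw : p w.length = w
  · have hpre : ∀ n, ∃ u, w ++ u = p (n + w.length) := fun n => by
      have := prefix_of_path hp (Nat.le_add_left w.length n)
      rwa [hw] at this
    choose q hq using hpre
    have hq0 : q 0 = [] := by
      have := hq 0
      rw [Nat.zero_add, hw] at this
      simpa using this
    have hqe : ∀ n, TreeEdge X (q n) (q (n + 1)) := fun n => by
      obtain ⟨x, hx⟩ := hp (n + w.length)
      refine ⟨x, ?_⟩
      rw [← hq n, show n + w.length + 1 = n + 1 + w.length by omega, ← hq (n + 1),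
        List.append_assoc, List.append_cancel_left_eq] at hx
      exact hx
    obtain ⟨F, hF, hrF⟩ := hr₁ _ ⟨q, hq0, hqe, rfl⟩
    refine ⟨F, hF, ?_⟩
    rw [← hrF]
    exact (infStates_eq_of_shift hqe hp w.length fun n => by rw [← hq, graft_append]).symm
  · obtain ⟨F, hF, hrF⟩ := hr _ ⟨p, hp0, hp, rfl⟩
    refine ⟨F, hF, ?_⟩
    rw [← hrF]
    exact infStates_eq_of_shift hp hp 0 fun n =>
      graft_of_not_prefix _ _ fun h => hw (path_apply_length hp0 hp h)

theorem isHom_ofConfig_iff {𝒜 : RabinAutomaton S X A} {f : List X → A} {r : List X → S} :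
    (RabinGraph.ofConfig f).IsHom 𝒜.toRabinGraph r ↔
      ∀ w, (r w, f w, fun x => r (w ++ [x])) ∈ 𝒜.transitions := by
  constructor
  · exact fun h w => h w (f w) _ ⟨w, rfl⟩
  · rintro h _ _ _ ⟨w, hw⟩
    simp only [Prod.mk.injEq] at hw
    obtain ⟨rfl, rfl, rfl⟩ := hw
    exact h _

end RabinAutomaton

open RabinAutomaton in
-- Equal types allow the run below `w` to be replaced by one starting in the same state `r w`.
theorem RabinRecognizable.finiteTypeAt {X A : Type*} {W : Set (List X → A)}
    (hW : RabinRecognizable W) (w : List X) : FiniteTypeAt W w := by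
  obtain ⟨S, hS, 𝒜, rfl⟩ := hW
  refine ⟨Set S, inferInstance, fun g => {s | ∃ r : List X → S,
    (∀ u, (r u, g u, fun x => r (u ++ [x])) ∈ 𝒜.transitions) ∧ r [] = s ∧ 𝒜.IsSuccessful r}, ?_⟩
  rintro f f' hf ht ⟨r, ⟨hr, hi⟩, hs⟩
  rw [isHom_ofConfig_iff] at hr
  obtain ⟨r₁, hr₁, h0, hs₁⟩ := (Set.ext_iff.1 ht (r w)).1
    ⟨fun u => r (w ++ u), fun u => by simpa using hr (w ++ u), by simp, hs.below w⟩
  refine ⟨graft w r r₁, ⟨isHom_ofConfig_iff.2 fun u => ?_, ?_⟩, hs.graft hs₁⟩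
  · by_cases hu : w <+: u
    · obtain ⟨u, rfl⟩ := hu
      simpa only [List.append_assoc, graft_append] using hr₁ u
    -- Only the parent of `w` could notice the graft among its children, and the state at `w` is
    -- unchanged.
    · have hc : (fun x => graft w r r₁ (u ++ [x])) = fun x => r (u ++ [x]) := by
        funext x
        by_cases hx : w <+: u ++ [x]
        · have hw := (List.prefix_concat_iff.1 hx).resolve_right hu
          have := graft_append w r r₁ []
          rwa [List.append_nil, h0, congrArg r hw, congrArg (graft w r r₁) hw] at this
        · exact graft_of_not_prefix _ _ hx
      rw [hc, graft_of_not_prefix _ _ hu, ← hf u hu]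
      exact hr u
  · by_cases hw : w = []
    · subst hw
      have := graft_append [] r r₁ []
      rw [List.append_nil, h0] at this
      rwa [this]
    · rw [graft_of_not_prefix _ _ (by simpa using hw)]
      exact hi

/-! ### The closure of a group of tree automorphisms -/

namespace TreeAut

variable {X : Type*}

theorem apply_eq_of_portrait_eq_of_length {g h : TreeAut X} {n : ℕ}
    (H : ∀ v : List X, v.length ≤ n → g.portrait v = h.portrait v) (v : List X)
    (hv : v.length ≤ n) : g v = h v := by
  induction v using List.reverseRecOn with
  | nil => rw [map_nil, map_nil]
  | append_singleton v x ih =>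
    have hv' : v.length ≤ n := by
      rw [List.length_append] at hv
      omega
    rw [apply_append_singleton, apply_append_singleton, ih hv', H v hv']

/-- The group of automorphisms that agree on every finite set of levels with an element of `G`. -/
def levelClosure (G : Subgroup (TreeAut X)) : Subgroup (TreeAut X) where
  carrier := {h | ∀ n : ℕ, ∃ g ∈ G, ∀ v : List X, v.length ≤ n → g v = h v}
  one_mem' _ := ⟨1, G.one_mem, fun _ _ => rfl⟩
  mul_mem' {a b} ha hb n := by
    obtain ⟨g, hg, hga⟩ := ha n
    obtain ⟨g', hg', hgb⟩ := hb n
    refine ⟨g * g', G.mul_mem hg hg', fun v hv => ?_⟩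
    rw [RelIso.mul_apply, RelIso.mul_apply, hgb v hv, hga _ (by rwa [length_map])]
  inv_mem' {a} ha n := by
    obtain ⟨g, hg, hga⟩ := ha n
    refine ⟨g⁻¹, G.inv_mem hg, fun v hv => ?_⟩
    have := hga (a⁻¹ v) (by rwa [length_map])
    rw [RelIso.apply_inv_self] at this
    rw [← this, RelIso.inv_apply_self, this]

theorem le_levelClosure (G : Subgroup (TreeAut X)) : G ≤ levelClosure G :=
  fun g hg _ => ⟨g, hg, fun _ _ => rfl⟩

/-- There are finitely many words of length at most `n`, so prescribing the labels there is an open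
condition. -/
theorem closure_subset_levelClosure [Finite X] (G : Subgroup (TreeAut X)) :
    @closure _ (treeAutTopology X) (G : Set (TreeAut X)) ⊆ levelClosure G := by
  intro h hh n
  let : TopologicalSpace (Equiv.Perm X) := ⊥
  have : DiscreteTopology (Equiv.Perm X) := ⟨rfl⟩
  have hfin : {v : List X | v.length ≤ n}.Finite := List.finite_length_le X n
  let U : Set (List X → Equiv.Perm X) := {f | ∀ v ∈ {v : List X | v.length ≤ n}, f v = h.portrait v}
  have hU : IsOpen U := by
    have : U = Set.pi {v : List X | v.length ≤ n} fun v => {h.portrait v} := rfl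
    rw [this]
    exact isOpen_set_pi hfin fun _ _ => isOpen_discrete _
  have hU' : @IsOpen _ (treeAutTopology X) (portrait ⁻¹' U) :=
    @isOpen_induced _ _ (prodiscrete X (Equiv.Perm X)) portrait U hU
  obtain ⟨g, hgU, hg⟩ := (@mem_closure_iff _ (treeAutTopology X) _ _).1 hh _ hU' fun _ _ => rfl
  exact ⟨g, hg, apply_eq_of_portrait_eq_of_length hgU⟩

/-! ### Rigid stabilizers -/

/-- `H` has nontrivial rigid stabilizers: for every vertex `w`, some element of `H` is supported
in the subtree at `w` and acts nontrivially there. -/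
def HasRigidElements (H : Subgroup (TreeAut X)) : Prop :=
  ∀ w : List X, ∃ d ∈ H, (∀ v, ¬ w <+: v → d v = v) ∧ ∃ u, d (w ++ u) ≠ w ++ u

/-- The image of `v` depends only on labels at proper prefixes of `v`, which is why `v = w` is still
covered. -/
theorem apply_eq_of_portrait_eq_off {g h : TreeAut X} {w : List X}
    (H : ∀ v, ¬ w <+: v → g.portrait v = h.portrait v) (v : List X) (hv : ¬ w <+: v ∨ v = w) :
    g v = h v := by
  induction v using List.reverseRecOn with
  | nil => rw [map_nil, map_nil]
  | append_singleton v x ih =>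
    have hv' : ¬ w <+: v := by
      intro hw
      rcases hv with hv | rfl
      · exact hv (hw.trans (List.prefix_append _ _))
      · simpa using hw.length_le
    rw [apply_append_singleton, apply_append_singleton, ih (Or.inl hv'), H v hv']

theorem apply_eq_of_portrait_eq_below {g h : TreeAut X} {w : List X} (hw : g w = h w)
    (H : ∀ u, g.portrait (w ++ u) = h.portrait (w ++ u)) (u : List X) :
    g (w ++ u) = h (w ++ u) := by
  induction u using List.reverseRecOn with
  | nil => simpa using hw
  | append_singleton u x ih =>
    rw [← List.append_assoc, apply_append_singleton, apply_append_singleton, ih, H u]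

theorem map_prefix_eq {g : TreeAut X} {w u v : List X} (h : g (w ++ u) = w ++ v) : g w = w := by
  rw [apply_append] at h
  exact (List.append_inj h (length_map g w)).1

/-- If the closure of a level-transitive group has finite type at every vertex, then it has
nontrivial rigid stabilizers. -/
theorem hasRigidElements [Finite X] [Nontrivial X] {G : Subgroup (TreeAut X)}
    (htrans : LevelTransitive G)
    (hW : ∀ w, FiniteTypeAt (portrait '' @closure _ (treeAutTopology X) (G : Set (TreeAut X))) w) :
    HasRigidElements (levelClosure G) := by
  classical
  intro w
  obtain ⟨T, hT, τ, hτ⟩ := hW w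
  let N := Nat.card T
  obtain ⟨x₀⟩ : Nonempty X := inferInstance
  let u₀ := List.replicate N x₀
  have hg : ∀ c : Fin N → X, ∃ g ∈ G, g (w ++ u₀) = w ++ List.ofFn c := fun c =>
    htrans _ _ _ rfl (by simp [u₀])
  choose g hgG hgc using hg
  have hcard : Nat.card T < Nat.card (Fin N → X) := by
    rw [Nat.card_fun, Nat.card_fin]
    exact Nat.lt_pow_self Finite.one_lt_card
  have hninj : ¬ Function.Injective fun c => τ fun u => (g c).portrait (w ++ u) := fun hinj =>
    (Nat.card_le_card_of_injective _ hinj).not_gt hcard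
  simp only [Function.Injective, not_forall] at hninj
  obtain ⟨c, c', hcc, hne⟩ := hninj
  -- The portrait of `g c` with its part below `w` taken from `g c'` belongs to some `h` in the
  -- closure.
  obtain ⟨h, hh, hf⟩ := hτ (g c).portrait
    (fun u => if w <+: u then (g c').portrait u else (g c).portrait u)
    (fun u hu => by simp [hu]) (by simpa using hcc) ⟨g c, @subset_closure _ (treeAutTopology X) _ _ (hgG c), rfl⟩
  have hoff := apply_eq_of_portrait_eq_off (g := h) (h := g c) (w := w) fun v hv => by
    rw [hf]
    simp [hv]
  have hbelow := apply_eq_of_portrait_eq_below (g := h) (h := g c') (w := w)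
    (by rw [hoff w (Or.inr rfl), map_prefix_eq (hgc c), map_prefix_eq (hgc c')])
    fun u => by
      rw [hf]
      simp
  -- Off the subtree `h` and `g c` cancel; at `w ++ u₀` they take the values `w ++ List.ofFn c'` and
  -- `w ++ List.ofFn c`.
  refine ⟨h⁻¹ * g c, Subgroup.mul_mem _ (Subgroup.inv_mem _ (closure_subset_levelClosure G hh))
    (le_levelClosure G (hgG c)), fun v hv => ?_, u₀, fun heq => ?_⟩
  · rw [RelIso.mul_apply, ← hoff v (Or.inl hv), RelIso.inv_apply_self]
  · have h1 := congrArg h heq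
    rw [RelIso.mul_apply, RelIso.apply_inv_self, hbelow, hgc, hgc, List.append_cancel_left_eq] at h1
    exact hne (List.ofFn_injective h1)

theorem not_nontrivial_center {G : Subgroup (TreeAut X)}
    (hR : HasRigidElements (levelClosure G)) : ¬ Nontrivial (Subgroup.center G) := by
  intro hnt
  obtain ⟨⟨⟨z, hzG⟩, hz⟩, hz1⟩ := exists_ne (1 : Subgroup.center G)
  have hz2 : ∃ w, z w ≠ w := by
    by_contra! hcon
    exact hz1 (Subtype.ext (Subtype.ext (RelIso.ext hcon)))
  obtain ⟨w, hw⟩ := hz2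
  obtain ⟨d, hd, hoff, u, hu⟩ := hR w
  -- Centrality concerns only `G`, so `d` is replaced by an element of `G` with the same action up
  -- to the level of `w ++ u`.
  obtain ⟨g, hg, hgd⟩ := hd (w ++ u).length
  have hcomm : g * z = z * g :=
    congrArg Subtype.val (Subgroup.mem_center_iff.1 hz ⟨g, hg⟩)
  have h1 := congrArg (fun k : TreeAut X => k (w ++ u)) hcomm
  simp only [RelIso.mul_apply] at h1
  rw [hgd _ le_rfl, hgd _ (by rw [length_map]), hoff] at h1
  · exact hu (z.injective h1).symm
  · intro hpre
    rw [apply_append] at hpre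
    exact hw ((List.prefix_of_prefix_length_le (List.prefix_append _ _) hpre
      (length_map z w).le).eq_of_length (length_map z w))

end TreeAut

/-! ### Separating actions and laws -/

section Law

variable {H Ω : Type*} [Group H] [MulAction H Ω]

/-- The value of a letter `i` or of its inverse under the substitution `s`. -/
def letterValue (s : ℕ → H) (a : ℕ × Bool) : H := cond a.2 (s a.1) (s a.1)⁻¹

/-- The points that a word visits when its letters are applied one after the other to `p`, the last
one first. -/
def visited (s : ℕ → H) (p : Ω) : List (ℕ × Bool) → List Ω
  | [] => [p]
  | a :: L => letterValue s a • (L.map (letterValue s)).prod • p :: visited s p L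

theorem prod_smul_mem_visited (s : ℕ → H) (p : Ω) (L : List (ℕ × Bool)) :
    (L.map (letterValue s)).prod • p ∈ visited s p L := by
  cases L with
  | nil => simp [visited]
  | cons a L => simp [visited, mul_smul]

theorem mem_visited_self (s : ℕ → H) (p : Ω) (L : List (ℕ × Bool)) : p ∈ visited s p L := by
  induction L with
  | nil => simp [visited]
  | cons a L ih => exact List.mem_cons_of_mem _ ih

/-- Change the substitution `s` so that the value of the letter `a` is multiplied by `h`. -/
def twist (s : ℕ → H) (a : ℕ × Bool) (h : H) : ℕ → H :=
  Function.update s a.1 (cond a.2 (s a.1 * h) (h⁻¹ * s a.1))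

theorem letterValue_twist_self (s : ℕ → H) (a : ℕ × Bool) (h : H) :
    letterValue (twist s a h) a = letterValue s a * h := by
  obtain ⟨i, _ | _⟩ := a <;> simp [letterValue, twist]

theorem letterValue_twist_inv (s : ℕ → H) (a : ℕ × Bool) (h : H) :
    letterValue (twist s a h) (a.1, !a.2) = h⁻¹ * letterValue s (a.1, !a.2) := by
  obtain ⟨i, _ | _⟩ := a <;> simp [letterValue, twist]

theorem letterValue_twist_of_ne (s : ℕ → H) {a c : ℕ × Bool} (h : H) (hc : c.1 ≠ a.1) :
    letterValue (twist s a h) c = letterValue s c := by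
  simp [letterValue, twist, Function.update_of_ne hc]

theorem eq_or_eq_or_fst_ne (a c : ℕ × Bool) : c = a ∨ c = (a.1, !a.2) ∨ c.1 ≠ a.1 := by
  obtain ⟨i, b⟩ := a
  obtain ⟨j, b'⟩ := c
  by_cases h : j = i
  · subst h
    cases b <;> cases b' <;> simp
  · exact Or.inr (Or.inr h)

theorem prod_smul_eq_of_visited_eq {s s' : ℕ → H} {p : Ω} {L : List (ℕ × Bool)}
    (h : visited s' p L = visited s p L) :
    (L.map (letterValue s')).prod • p = (L.map (letterValue s)).prod • p := by
  cases L with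
  | nil => simp
  | cons a L =>
    simp only [visited, List.cons.injEq] at h
    simpa [mul_smul] using h.1

/-- The twist inserts `h` before a letter `a`, or `h⁻¹` after its inverse; either way it acts at a
visited point. -/
theorem visited_twist_of_fixed {s : ℕ → H} {p : Ω} {a : ℕ × Bool} {h : H} {L : List (ℕ × Bool)}
    (hfix : ∀ y ∈ visited s p L, h • y = y) : visited (twist s a h) p L = visited s p L := by
  induction L with
  | nil => rfl
  | cons c L ih =>
    have hL := ih fun y hy => hfix y (List.mem_cons_of_mem _ hy)
    have htop := hfix _ (List.mem_cons_self (a := letterValue s c • _) (l := visited s p L))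
    rw [visited, visited, hL, prod_smul_eq_of_visited_eq hL]
    congr 1
    rcases eq_or_eq_or_fst_ne a c with rfl | rfl | hc
    · rw [letterValue_twist_self, mul_smul,
        hfix _ (List.mem_cons_of_mem _ (prod_smul_mem_visited s p L))]
    · rw [letterValue_twist_inv, mul_smul, inv_smul_eq_iff, htop]
    · rw [letterValue_twist_of_ne s h hc]

/-- The endpoint need not be fixed: `h⁻¹` would act there only if the word began with the inverse of
`a`, which reducedness of `a :: L` excludes. -/
theorem visited_twist {s : ℕ → H} {p : Ω} {a : ℕ × Bool} {h : H} {L : List (ℕ × Bool)}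
    (hred : FreeGroup.IsReduced (a :: L)) (hfix : ∀ y ∈ (visited s p L).tail, h • y = y) :
    visited (twist s a h) p L = visited s p L := by
  cases L with
  | nil => rfl
  | cons c L =>
    have hfix' : ∀ y ∈ visited s p L, h • y = y := hfix
    have hL := visited_twist_of_fixed (a := a) hfix'
    rw [visited, visited, hL, prod_smul_eq_of_visited_eq hL]
    congr 1
    rcases eq_or_eq_or_fst_ne a c with rfl | rfl | hc
    · rw [letterValue_twist_self, mul_smul, hfix' _ (prod_smul_mem_visited s p L)]
    · have := (FreeGroup.isReduced_cons_cons.1 hred).1 rfl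
      simp at this
    · rw [letterValue_twist_of_ne s h hc]

/-- If the pointwise stabilizer of each finite set moves each point outside the set, then it moves
such a point out of any given finite set. -/
theorem exists_smul_notMem_of_separating
    (hsep : ∀ (Y : Finset Ω) (x : Ω), x ∉ Y → ∃ h : H, (∀ y ∈ Y, h • y = y) ∧ h • x ≠ x)
    (Y Z : Finset Ω) (x : Ω) (hx : x ∉ Y) : ∃ h : H, (∀ y ∈ Y, h • y = y) ∧ h • x ∉ Z := by
  classical
  by_contra! hcon
  -- If `h • x` stayed in `Z`, it would lie in `Z.erase x` and be fixed by `h`, forcing `h • x = x`.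
  obtain ⟨h, hY, hhx⟩ := hsep (Y ∪ Z.erase x) x (by simp [hx])
  have hZ := hcon h fun y hy => hY y (Finset.mem_union_left _ hy)
  have := hY (h • x) (Finset.mem_union_right _ (Finset.mem_erase.2 ⟨hhx, hZ⟩))
  exact hhx (MulAction.injective h this)

theorem exists_nodup_visited
    (hsep : ∀ (Y : Finset Ω) (x : Ω), x ∉ Y → ∃ h : H, (∀ y ∈ Y, h • y = y) ∧ h • x ≠ x)
    (p : Ω) (L : List (ℕ × Bool)) (hL : FreeGroup.IsReduced L) :
    ∃ s : ℕ → H, (visited s p L).Nodup := by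
  classical
  induction L with
  | nil => exact ⟨1, by simp [visited]⟩
  | cons a L ih =>
    obtain ⟨s, hs⟩ := ih (FreeGroup.IsReduced.infix hL (List.suffix_cons a L).isInfix)
    set x := (L.map (letterValue s)).prod • p with hxdef
    have hx : x ∉ (visited s p L).tail.toFinset := by
      rw [List.mem_toFinset]
      cases L with
      | nil => simp [visited]
      | cons c L =>
        have := (List.nodup_cons.1 hs).1
        simpa [hxdef, visited, mul_smul] using this
    -- The forbidden set is the preimage of the visited points under the letter `a`, so the next
    -- point is new.
    obtain ⟨h, hfix, hout⟩ := exists_smul_notMem_of_separating hsep _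
      ((visited s p L).toFinset.image fun y => (letterValue s a)⁻¹ • y) x hx
    have hv := visited_twist (h := h) hL fun y hy => hfix y (List.mem_toFinset.2 hy)
    refine ⟨twist s a h, ?_⟩
    rw [visited, hv, prod_smul_eq_of_visited_eq hv, letterValue_twist_self, List.nodup_cons]
    refine ⟨fun hmem => hout ?_, hs⟩
    rw [Finset.mem_image]
    exact ⟨_, List.mem_toFinset.2 hmem, by rw [mul_smul, inv_smul_smul]⟩

/-- Abért's theorem: a group with a separating action satisfies no law. -/
theorem not_satisfiesLaw_of_separating [Nonempty Ω]
    (hsep : ∀ (Y : Finset Ω) (x : Ω), x ∉ Y → ∃ h : H, (∀ y ∈ Y, h • y = y) ∧ h • x ≠ x) :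
    ¬ SatisfiesLaw H := by
  rintro ⟨ω, hω, hlaw⟩
  obtain ⟨p⟩ := ‹Nonempty Ω›
  obtain ⟨s, hs⟩ := exists_nodup_visited hsep p ω.toWord FreeGroup.isReduced_toWord
  have h1 : FreeGroup.lift s ω = (ω.toWord.map (letterValue s)).prod := by
    conv_lhs => rw [← FreeGroup.mk_toWord (x := ω)]
    rw [FreeGroup.lift_mk]
    rfl
  rw [hlaw s] at h1
  have hne : ω.toWord ≠ [] := fun h => hω (FreeGroup.toWord_eq_nil_iff.1 h)
  obtain ⟨a, L, haL⟩ := List.exists_cons_of_ne_nil hne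
  rw [haL] at hs h1
  -- Since the word has value `1`, the trajectory ends at its start `p`, a repetition.
  rw [visited, ← mul_smul, ← List.prod_cons, ← List.map_cons, ← h1, one_smul] at hs
  exact (List.nodup_cons.1 hs).1 (mem_visited_self s p L)

end Law

/-! ### The action on the boundary -/

/-- The boundary of the tree: infinite paths from the root. -/
abbrev Boundary (X : Type*) : Type _ :=
  {p : ℕ → List X // p 0 = [] ∧ ∀ n, TreeEdge X (p n) (p (n + 1))}

namespace TreeAut

variable {X : Type*}

instance : MulAction (TreeAut X) (Boundary X) where
  smul g p := ⟨fun n => g (p.1 n), by simp [p.2.1, map_nil], fun n => g.map_rel_iff.2 (p.2.2 n)⟩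
  one_smul _ := rfl
  mul_smul _ _ _ := rfl

theorem smul_boundary_apply (g : TreeAut X) (p : Boundary X) (n : ℕ) :
    (g • p).1 n = g (p.1 n) := rfl

/-- Beyond some level `x` leaves every path in `Y`; a rigid element at that vertex of `x`,
conjugated within the subtree, fixes `Y` and moves `x`. -/
theorem separating_boundary {G H : Subgroup (TreeAut X)} (hGH : G ≤ H)
    (htrans : LevelTransitive G) (hR : HasRigidElements H) (Y : Finset (Boundary X))
    (x : Boundary X) (hx : x ∉ Y) : ∃ h : H, (∀ y ∈ Y, h • y = y) ∧ h • x ≠ x := by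
  have hlen : ∀ (p : Boundary X) n, (p.1 n).length = n := fun p n => by
    rw [length_of_path p.2.2, p.2.1]
    simp
  have hev : ∀ y ∈ Y, ∀ᶠ n in Filter.atTop, x.1 n ≠ y.1 n := by
    intro y hy
    have hxy : x.1 ≠ y.1 := fun h => hx (Subtype.ext h ▸ hy)
    obtain ⟨k, hk⟩ := Function.ne_iff.1 hxy
    filter_upwards [Filter.eventually_ge_atTop k] with n hn heq
    have h1 := prefix_of_path x.2.2 hn
    rw [heq] at h1
    exact hk ((List.prefix_of_prefix_length_le h1 (prefix_of_path y.2.2 hn)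
      (by rw [hlen, hlen])).eq_of_length (by rw [hlen, hlen]))
  obtain ⟨n, hn⟩ := ((Filter.eventually_all_finset Y).2 hev).exists
  obtain ⟨d, hd, hoff, u, hu⟩ := hR (x.1 n)
  obtain ⟨t, ht⟩ := prefix_of_path x.2.2 (Nat.le_add_right n u.length)
  have htl : t.length = u.length := by
    have := congrArg List.length ht
    rw [List.length_append, hlen, hlen] at this
    omega
  -- The rigid element moves `x.1 n ++ u`, which need not lie on `x`; `s` carries a vertex of `x` to
  -- it and fixes `x.1 n`.
  obtain ⟨s, hs, hst⟩ := htrans _ (x.1 n ++ t) (x.1 n ++ u) rfl (by simp [htl])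
  have hsn : s (x.1 n) = x.1 n := map_prefix_eq hst
  refine ⟨⟨s⁻¹ * d * s, H.mul_mem (H.mul_mem (H.inv_mem (hGH hs)) hd) (hGH hs)⟩, ?_, ?_⟩
  · intro y hy
    refine Subtype.ext (funext fun m => ?_)
    change s⁻¹ (d (s (y.1 m))) = y.1 m
    rw [hoff, RelIso.inv_apply_self]
    intro hpre
    have hmn : n ≤ m := by simpa [length_map, hlen] using hpre.length_le
    obtain ⟨e, he⟩ := prefix_of_path y.2.2 hmn
    rw [← he, apply_append] at hpre
    have h2 : x.1 n = s (y.1 n) :=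
      (List.prefix_of_prefix_length_le hpre (List.prefix_append _ _)
        (by rw [length_map, hlen, hlen])).eq_of_length (by rw [length_map, hlen, hlen])
    exact hn y hy (s.injective (hsn.trans h2))
  · intro heq
    have h1 : s⁻¹ (d (s (x.1 (n + u.length)))) = x.1 (n + u.length) :=
      congrArg (fun p : Boundary X => p.1 (n + u.length)) heq
    rw [← ht, hst] at h1
    have h2 := congrArg s h1
    rw [RelIso.apply_inv_self, hst] at h2
    exact hu h2

instance [Nonempty X] : Nonempty (Boundary X) := by
  obtain ⟨x⟩ := ‹Nonempty X›
  exact ⟨⟨fun n => List.replicate n x, rfl, fun n => ⟨x, List.replicate_succ'⟩⟩⟩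

/-- The value of a group word at `u` involves only the level of `u`, where the substituted elements
can be replaced by elements of `G`. -/
theorem satisfiesLaw_levelClosure {G : Subgroup (TreeAut X)} (hG : SatisfiesLaw G) :
    SatisfiesLaw (levelClosure G) := by
  obtain ⟨ω, hω, hlaw⟩ := hG
  refine ⟨ω, hω, fun s => Subtype.ext (RelIso.ext fun u => ?_)⟩
  have happrox : ∀ i, ∃ g : G, ∀ v : List X, v.length ≤ u.length → g.1 v = (s i).1 v := fun i => by
    obtain ⟨g, hg, h⟩ := (s i).2 u.length
    exact ⟨⟨g, hg⟩, h⟩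
  choose g hg using happrox
  have key : ∀ (ψ : FreeGroup ℕ) (v : List X), v.length ≤ u.length →
      (FreeGroup.lift g ψ).1 v = (FreeGroup.lift s ψ).1 v := by
    intro ψ
    refine FreeGroup.induction_on ψ (by simp) (fun i => by simpa using hg i) ?_ ?_
    · intro i ih v hv
      have := ih ((FreeGroup.lift s (FreeGroup.of i)).1⁻¹ v) (by rwa [length_map])
      rw [RelIso.apply_inv_self] at this
      rw [_root_.map_inv, _root_.map_inv, Subgroup.coe_inv, Subgroup.coe_inv]
      rw [← RelIso.inv_apply_self (FreeGroup.lift g (FreeGroup.of i)).1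
        ((FreeGroup.lift s (FreeGroup.of i)).1⁻¹ v), this]
    · intro a b iha ihb v hv
      rw [_root_.map_mul, _root_.map_mul, Subgroup.coe_mul, Subgroup.coe_mul, RelIso.mul_apply,
        RelIso.mul_apply, ihb v hv, iha _ (by rwa [length_map])]
  rw [← key ω u le_rfl, hlaw g]
  rfl

/-- Level-transitivity suffices here: it yields infinitely many sections at each vertex `w`, two of
which have the same type, and replacing one by the other gives a nontrivial element of the closure
that is supported below `w`. -/
theorem not_forall_finiteTypeAt [Finite X] [Nontrivial X] {G : Subgroup (TreeAut X)}
    (htrans : LevelTransitive G) (hG : SatisfiesLaw G ∨ Nontrivial (Subgroup.center G)) :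
    ¬ ∀ w, FiniteTypeAt
      (portrait '' @closure _ (treeAutTopology X) (G : Set (TreeAut X))) w := by
  intro hW
  have hR := hasRigidElements htrans hW
  rcases hG with hG | hG
  · exact not_satisfiesLaw_of_separating (Ω := Boundary X)
      (separating_boundary (le_levelClosure G) htrans hR) (satisfiesLaw_levelClosure hG)
  · exact not_nontrivial_center hR hG

end TreeAut

theorem mainTheorem2 {X : Type*} [Finite X] [Nontrivial X] (G : Subgroup (TreeAut X))
    (hsim : TreeAut.SelfSimilar G) (htrans : TreeAut.LevelTransitive G)
    (hM : ∃ M : Subgroup (TreeAut X),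
      (M ≤ G ∨ M ≤ Subgroup.normalizer (G : Set (TreeAut X))) ∧
        TreeAut.SelfReplicating M ∧ TreeAut.LevelTransitive M)
    (hG : SatisfiesLaw G ∨ Nontrivial (Subgroup.center G)) :
    ¬ RabinRecognizable (TreeAut.portrait '' @closure _ (treeAutTopology X) (G : Set (TreeAut X))) ∧
      ¬ SkSDefinable
        (TreeAut.portrait '' @closure _ (treeAutTopology X) (G : Set (TreeAut X))) := by
  exact ⟨fun h => TreeAut.not_forall_finiteTypeAt htrans hG h.finiteTypeAt,
    fun h => TreeAut.not_forall_finiteTypeAt htrans hG h.finiteTypeAt⟩
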